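/- Let $p_0\ge 1$, let $\boldsymbol{\alpha}$ be a probability vector of length $p_0$ (a row vector), and let $A$ be a real $p_0\times p_0$ matrix such that \[\Lambda=\begin{pmatrix}0&\mathbf 0\\ -A\mathbf 1&A\end{pmatrix}\] is the generator of a time-homogeneous Markov jump process on $\{\star\}\cup\{1,\dots,p_0\}$ in which $\star$ is absorbing and the states $1,\dots,p_0$ are all transient. Let $Y\sim\mathrm{PH}(\boldsymbol{\alpha},A)$, that is, $Y$ is a real random variable distributed as $\inf\{t\ge 0:\varphi(t)=\star\}$, where $\varphi$ is a Markov jump process with generator $\Lambda$ and initial distribution $(0\mid\boldsymbol{\alpha})$. Let $-\sigma_0$ be the dominant eigenvalue of $A$, i.e. its eigenvalue with the largest real part (which is real and negative), and let $\nu_0=\max_{1\le i\le p_0}(-A\mathbf 1)_i$. Fix $\nu\in[\nu_0,\infty)$, $p\in\{p_0,p_0+1,p_0+2,\dots\}$ and $\sigma\in(0,\sigma_0]$. Then \[L\le_{\mathrm{st}}Y\le_{\mathrm{st}}H,\] where $L\sim\mathrm{Exp}(\nu)$ and $H\sim\mathrm{Erlang}(p,\sigma)$ (density $\sigma^p x^{p-1}e^{-\sigma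 x}/(p-1)!$ on $[0,\infty)$), and $X_1\le_{\mathrm{st}}X_2$ means that $P(X_1>x)\le P(X_2>x)$ for all $x$. -/

import Mathlib

open MeasureTheory ProbabilityTheory Filter Topology
open scoped NNReal

universe w

namespace PhaseType

/-- The exit-rate vector `-A𝟏` of a square matrix `A`: the rates from the states of `A` to the
absorbing state. -/
def exitRate {p : ℕ} (A : Matrix (Fin p) (Fin p) ℝ) (i : Fin p) : ℝ :=
  -∑ j, A i j

/-- The matrix `[[0, 0], [-A𝟏, A]]` on the state space `{⋆} ∪ {1, …, p}`. The absorbing state `⋆`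
is `none`, the other states are `some i`. -/
def generator {p : ℕ} (A : Matrix (Fin p) (Fin p) ℝ) :
    Matrix (Option (Fin p)) (Option (Fin p)) ℝ :=
  fun x y =>
    match x, y with
    | none, _ => 0
    | some i, none => exitRate A i
    | some i, some j => A i j

/-- The row vector `[0 | α]` on `{⋆} ∪ {1, …, p}`. -/
def initialVector {p : ℕ} (α : Fin p → ℝ) : Option (Fin p) → ℝ
  | none => 0
  | some i => α i

/-- The state `i` is transient for the Markov jump process with generator `Q`: starting from `i`,
the expected total time spent in `i`, namely `∫₀^∞ (e^{tQ})_{ii} dt`, is finite. -/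
def IsTransientState {E : Type*} [Fintype E] [DecidableEq E] (Q : Matrix E E ℝ) (i : E) : Prop :=
  IntegrableOn (fun t : ℝ => NormedSpace.exp (t • Q) i i) (Set.Ioi 0) volume

/-- `A` is a sub-generator: the rates between distinct states of the process with generator
`[[0, 0], [-A𝟏, A]]` are nonnegative (its rows sum to zero by construction), and all the states
other than `⋆` are transient. -/
structure IsSubGenerator {p : ℕ} (A : Matrix (Fin p) (Fin p) ℝ) : Prop where
  rate_nonneg : ∀ i j, i ≠ j → 0 ≤ A i j
  exitRate_nonneg : ∀ i, 0 ≤ exitRate A i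
  transient : ∀ i : Fin p, IsTransientState (generator A) (some i)

/-- `φ` is a time-homogeneous Markov jump process on the finite set `E` with initial
distribution `π` and generator `Q`: it is measurable, its paths are right-continuous for the
discrete topology on `E`, and its finite-dimensional distributions are
`P(φ(t₀) = i₀, …, φ(tₙ) = iₙ) = π(i₀) ∏ₖ (e^{(tₖ₊₁ - tₖ)Q})(iₖ, iₖ₊₁)` for
`0 = t₀ ≤ t₁ ≤ … ≤ tₙ`. -/
structure IsMarkovJumpProcess {E : Type*} [Fintype E] [DecidableEq E]
    {Ω : Type*} [MeasurableSpace Ω] (P : Measure Ω)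
    (π : E → ℝ) (Q : Matrix E E ℝ) (φ : ℝ≥0 → Ω → E) : Prop where
  measurableSet_eq : ∀ t i, MeasurableSet {ω | φ t ω = i}
  right_continuous : ∀ ω t, ∀ᶠ s in 𝓝[≥] t, φ s ω = φ t ω
  finite_dim : ∀ (n : ℕ) (t : Fin (n + 1) → ℝ≥0) (i : Fin (n + 1) → E),
    t 0 = 0 → Monotone t →
      P.real {ω | ∀ k, φ (t k) ω = i k} =
        π (i 0) * ∏ k : Fin n,
          NormedSpace.exp (((t k.succ : ℝ) - (t k.castSucc : ℝ)) • Q) (i k.castSucc) (i k.succ)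

/-- The time `inf {t ≥ 0 | φ(t) = ⋆}` before absorption; it is `⊤` if `⋆` is never reached. -/
noncomputable def absorptionTime {p : ℕ} {Ω : Type*} (φ : ℝ≥0 → Ω → Option (Fin p)) (ω : Ω) :
    EReal :=
  sInf {x : EReal | ∃ t : ℝ≥0, φ t ω = none ∧ x = ((t : ℝ) : EReal)}

/-- `Y ∼ PH(α, A)`: the vector `α` is a probability vector, `A` is a sub-generator, and `Y` is
distributed as the time before absorption of a Markov jump process with initial distribution
`[0 | α]` and generator `[[0, 0], [-A𝟏, A]]`. -/
structure IsPhaseType {p : ℕ} (α : Fin p → ℝ) (A : Matrix (Fin p) (Fin p) ℝ)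
    {Ω : Type*} [MeasurableSpace Ω] (Y : Ω → ℝ) (P : Measure Ω) : Prop where
  initial_nonneg : ∀ i, 0 ≤ α i
  initial_sum : ∑ i, α i = 1
  subGenerator : IsSubGenerator A
  law : ∃ (Ω' : Type w) (_ : MeasurableSpace Ω') (P' : Measure Ω') (_ : IsProbabilityMeasure P')
    (φ : ℝ≥0 → Ω' → Option (Fin p)),
    IsMarkovJumpProcess P' (initialVector α) (generator A) φ ∧
      IdentDistrib (fun ω => (Y ω : EReal)) (absorptionTime φ) P P'

/-- `z` is a dominant eigenvalue of the real matrix `A`: a complex eigenvalue of `A` with the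
largest real part. -/
def IsDominantEigenvalue {p : ℕ} (A : Matrix (Fin p) (Fin p) ℝ) (z : ℂ) : Prop :=
  Module.End.HasEigenvalue (Matrix.toLin' (A.map Complex.ofReal)) z ∧
    ∀ y : ℂ, Module.End.HasEigenvalue (Matrix.toLin' (A.map Complex.ofReal)) y → y.re ≤ z.re

/-- The Erlang distribution with `p` phases and rate `σ`, of density
`σ^p x^(p-1) e^(-σx) / (p-1)!` on `[0, ∞)`. -/
noncomputable def erlangMeasure (p : ℕ) (σ : ℝ) : Measure ℝ :=
  gammaMeasure (p : ℝ) σ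

/-- The usual stochastic order `X ≤_st Y` of two random variables, possibly defined on different
probability spaces: `P(X > x) ≤ P(Y > x)` for all `x`. -/
def StochLE {Ω₁ : Type*} {Ω₂ : Type*} [MeasurableSpace Ω₁] [MeasurableSpace Ω₂]
    (X : Ω₁ → ℝ) (P₁ : Measure Ω₁) (Y : Ω₂ → ℝ) (P₂ : Measure Ω₂) : Prop :=
  ∀ x : ℝ, P₁ {ω | x < X ω} ≤ P₂ {ω | x < Y ω}

end PhaseType

/-! Absorption is permanent up to null sets, so `P(Y > x) = α e^{xA} 𝟏`, and it suffices to bound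
`e^{tA} 𝟏` entrywise. The lower bound `e^{-νt}` uses only that the row sums of `A` are at least `-ν`
(`exp_neg_le_exp_smul_mulVec_one`).

For the upper bound, take `σ` strictly below `σ₀`. There is then a positive `v` with `A v ≤ -σ v`
(`exists_pos_mulVec_le`). Uniformization with a large rate `c` gives the nonnegative matrix `P =
c⁻¹(A + (c + σ)I)`, with `P v ≤ v` and `P 𝟏 ≤ (1 + a)𝟏`, where `a = σ / c`. If `P ^ n 𝟏` is bounded
by the first `p₀` terms of the binomial expansion of `(1 + a)^n`, exponential summation over `n`
gives exactly the Erlang survival function.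

The bound on `P ^ n 𝟏` comes from an induction on `(P ^ n 𝟏)ᵢ ≤ vᵢ Fₙ(1/vᵢ)`, with `Fₙ` concave,
piecewise linear, and with breakpoints at the distinct values of `1/v`. Bounding `Fₙ` by its tangent
at `1/vᵢ` and applying `P` yields `Fₙ₊₁(y) = Fₙ(y) + a y Fₙ'(y+)` at each breakpoint `y`. For small
`a` concavity survives, and Pascal's rule bounds the slopes by truncated binomials. There are at
most `p₀` breakpoints, hence at most `p₀` terms. The endpoint `σ = σ₀` follows by continuity. -/

namespace PhaseType

/-! ### The concave majorants `Fₙ`: slopes and values -/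

/-- The slopes of the concave majorant after `n` steps; the breakpoints are numbered from the
largest one downwards. -/
def slope (a : ℝ) (ρ : ℕ → ℝ) : ℕ → ℕ → ℝ
  | 0, 0 => 0
  | 0, _ + 1 => 1
  | _ + 1, 0 => 0
  | n + 1, k + 1 =>
    slope a ρ n (k + 1) - ρ (k + 1) * (slope a ρ n (k + 1) - slope a ρ n k) + a * slope a ρ n k

/-- The values of the concave majorant at the breakpoints `y k` after `n` steps. -/
def majorant (a : ℝ) (ρ y : ℕ → ℝ) : ℕ → ℕ → ℝ
  | 0, k => y k
  | n + 1, k => majorant a ρ y n k + a * y k * slope a ρ n k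

/-- The binomial expansion of `(1 + a) ^ n`, truncated after `k` terms. -/
def truncBinom (a : ℝ) (n k : ℕ) : ℝ := ∑ l ∈ Finset.range k, (n.choose l : ℝ) * a ^ l

lemma truncBinom_succ_succ (a : ℝ) (n k : ℕ) :
    truncBinom a (n + 1) (k + 1) = truncBinom a n (k + 1) + a * truncBinom a n k := by
  simp only [truncBinom]
  rw [Finset.sum_range_succ', Finset.sum_range_succ' _ k, Finset.mul_sum, add_right_comm,
    ← Finset.sum_add_distrib]
  congr 1
  · refine Finset.sum_congr rfl fun l _ => ?_
    rw [Nat.choose_succ_succ]; push_cast; ring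
  · simp

lemma truncBinom_mono {a : ℝ} (ha : 0 ≤ a) (n : ℕ) : Monotone (truncBinom a n) := fun _ _ h =>
  Finset.sum_le_sum_of_subset_of_nonneg (Finset.range_mono h) fun _ _ _ => by positivity

section Slope

variable {a : ℝ} {ρ : ℕ → ℝ}

lemma slope_zero_right (n : ℕ) : slope a ρ n 0 = 0 := by
  cases n <;> rfl

/-- This is the concavity of `Fₙ`, as breakpoints decrease with the index and `slope a ρ n k` is the
slope just to the right of `y k`. Away from the boundary index, a new increment is `1 - ρ (k + 2)`
times the old one plus `ρ (k + 1) + a` times its predecessor; this is where `ρ ≤ 1` enters. -/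
lemma slope_mono (ha : 0 ≤ a) (hρ0 : ∀ k, 0 ≤ ρ k) (hρ1 : ∀ k, ρ k ≤ 1) (n : ℕ) :
    Monotone (slope a ρ n) := by
  induction n with
  | zero =>
    refine monotone_nat_of_le_succ fun k => ?_
    cases k <;> simp [slope]
  | succ n ih =>
    refine monotone_nat_of_le_succ fun k => ?_
    cases k with
    | zero =>
      have h := ih (Nat.zero_le 1)
      simp only [slope, slope_zero_right] at h ⊢
      nlinarith [mul_nonneg (sub_nonneg.2 (hρ1 1)) h]
    | succ k =>
      have h1 := sub_nonneg.2 (ih (Nat.le_succ (k + 1)))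
      have h2 := sub_nonneg.2 (ih (Nat.le_succ k))
      simp only [slope, Nat.succ_eq_add_one] at h1 h2 ⊢
      nlinarith [mul_nonneg (sub_nonneg.2 (hρ1 (k + 2))) h1, mul_nonneg (hρ0 (k + 1)) h2,
        mul_nonneg ha h2]

lemma slope_nonneg (ha : 0 ≤ a) (hρ0 : ∀ k, 0 ≤ ρ k) (hρ1 : ∀ k, ρ k ≤ 1) (n k : ℕ) :
    0 ≤ slope a ρ n k :=
  (slope_zero_right (a := a) (ρ := ρ) n).symm.le.trans (slope_mono ha hρ0 hρ1 n (Nat.zero_le k))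

/-- Dropping the nonpositive `ρ` term from the slope recursion leaves Pascal's rule for truncated
binomial sums. -/
lemma slope_le_truncBinom (ha : 0 ≤ a) (hρ0 : ∀ k, 0 ≤ ρ k) (hρ1 : ∀ k, ρ k ≤ 1) (n k : ℕ) :
    slope a ρ n k ≤ truncBinom a n k := by
  induction n generalizing k with
  | zero =>
    cases k with
    | zero => simp [slope, truncBinom]
    | succ k => simp [slope, truncBinom, Finset.sum_range_succ']
  | succ n ih =>
    cases k with
    | zero => simp [slope, truncBinom]
    | succ k =>
      rw [truncBinom_succ_succ, slope]
      have h := sub_nonneg.2 (slope_mono ha hρ0 hρ1 n (Nat.le_succ k))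
      have := mul_nonneg (hρ0 (k + 1)) h
      simp only [Nat.succ_eq_add_one] at this
      linarith [ih (k + 1), mul_le_mul_of_nonneg_left (ih k) ha]

variable {y : ℕ → ℝ} {m : ℕ}

lemma majorant_le (ha : 0 ≤ a) (hρ0 : ∀ k, 0 ≤ ρ k) (hρ1 : ∀ k, ρ k ≤ 1) (n : ℕ) {k : ℕ}
    (hy : 0 ≤ y k) : majorant a ρ y n k ≤ y k * truncBinom a n (k + 1) := by
  induction n with
  | zero => simp [majorant, truncBinom, Finset.sum_range_succ']
  | succ n ih =>
    rw [majorant, truncBinom_succ_succ]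
    nlinarith [mul_le_mul_of_nonneg_left (slope_le_truncBinom ha hρ0 hρ1 n k) (mul_nonneg ha hy)]

/-- The tangent to `Fₙ` at `y k` has a nonnegative intercept at `0`. This sign is what allows `P v ≤
v` to be used in the induction on powers. -/
lemma slope_mul_le_majorant (ha : 0 ≤ a) (hρ0 : ∀ k, 0 ≤ ρ k) (hρ1 : ∀ k, ρ k ≤ 1) (n : ℕ) {k : ℕ}
    (hy : 0 ≤ y k) : slope a ρ n k * y k ≤ majorant a ρ y n k := by
  induction n with
  | zero => cases k <;> simp [majorant, slope, hy]
  | succ n ih =>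
    cases k with
    | zero =>
      simp only [majorant, slope_zero_right] at ih ⊢
      linarith
    | succ k =>
      have h := sub_nonneg.2 (slope_mono ha hρ0 hρ1 n (Nat.le_succ k))
      simp only [majorant, slope, Nat.succ_eq_add_one] at h ih ⊢
      nlinarith [mul_nonneg (mul_nonneg (hρ0 (k + 1)) h) hy, mul_nonneg (mul_nonneg ha h) hy]

/-- The relation `hy` makes the slope recursion agree with the difference quotients of the updated
values, so that `slope` really is the slope of the interpolation. -/
lemma majorant_sub (hy : ∀ k, k + 1 < m → ρ (k + 1) * (y k - y (k + 1)) = a * y (k + 1))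
    (n : ℕ) {k : ℕ} (hk : k + 1 < m) :
    majorant a ρ y n k - majorant a ρ y n (k + 1) = slope a ρ n (k + 1) * (y k - y (k + 1)) := by
  induction n with
  | zero => simp [majorant, slope]
  | succ n ih =>
    simp only [majorant, slope]
    linear_combination ih + (slope a ρ n (k + 1) - slope a ρ n k) * hy k hk

lemma majorant_le_tangent (ha : 0 ≤ a) (hρ0 : ∀ k, 0 ≤ ρ k) (hρ1 : ∀ k, ρ k ≤ 1)
    (hy : ∀ k, k + 1 < m → ρ (k + 1) * (y k - y (k + 1)) = a * y (k + 1))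
    (hanti : ∀ k, k + 1 < m → y (k + 1) ≤ y k) (n : ℕ) {j k : ℕ} (hj : j < m) (hk : k < m) :
    majorant a ρ y n j ≤ majorant a ρ y n k + slope a ρ n k * (y j - y k) := by
  rcases le_total j k with h | h
  · induction k, h using Nat.le_induction with
    | base => simp
    | succ k hjk ih =>
      have h1 := ih (by omega)
      have h2 := majorant_sub hy n hk
      have h3 := slope_mono ha hρ0 hρ1 n (Nat.le_succ k)
      have h4 : y k ≤ y j := by
        clear ih h1 h2 h3
        induction k, hjk using Nat.le_induction with
        | base => exact le_rfl
        | succ k hjk ih => exact (hanti k (by omega)).trans (ih (by omega))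
      simp only [Nat.succ_eq_add_one] at h3
      nlinarith [mul_nonneg (sub_nonneg.2 h3) (sub_nonneg.2 h4)]
  · induction j, h using Nat.le_induction with
    | base => simp
    | succ j hkj ih =>
      have h1 := ih (by omega)
      have h2 := majorant_sub hy n hj
      have h3 := slope_mono ha hρ0 hρ1 n (hkj.trans (Nat.le_succ j))
      simp only [Nat.succ_eq_add_one] at h3
      nlinarith [mul_nonneg (sub_nonneg.2 h3) (sub_nonneg.2 (hanti j hj))]

end Slope

/-! ### Powers of a nonnegative matrix with a superharmonic vector -/

section Power

variable {ι : Type*} [Fintype ι] [DecidableEq ι]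

lemma pow_succ_mulVec_apply (P : Matrix ι ι ℝ) (n : ℕ) (u : ι → ℝ) (i : ι) :
    (P ^ (n + 1)).mulVec u i = ∑ j, P i j * (P ^ n).mulVec u j := by
  rw [pow_succ', ← Matrix.mulVec_mulVec]; rfl

/-- Powers of a nonnegative matrix `P` with a positive superharmonic vector `v` that takes its
values among the `m` numbers `(y k)⁻¹`. -/
lemma pow_mulVec_one_le_of_values {a : ℝ} {ρ y : ℕ → ℝ} {m : ℕ} (ha : 0 ≤ a)
    (hρ0 : ∀ k, 0 ≤ ρ k) (hρ1 : ∀ k, ρ k ≤ 1)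
    (hy : ∀ k, k + 1 < m → ρ (k + 1) * (y k - y (k + 1)) = a * y (k + 1))
    (hanti : ∀ k, k + 1 < m → y (k + 1) ≤ y k)
    {P : Matrix ι ι ℝ} (hP : ∀ i j, 0 ≤ P i j) {v : ι → ℝ} (hv : ∀ i, 0 < v i)
    (hPv : ∀ i, ∑ j, P i j * v j ≤ v i) (hP1 : ∀ i, ∑ j, P i j ≤ 1 + a)
    {κ : ι → ℕ} (hκ : ∀ i, κ i < m) (hκv : ∀ i, v i * y (κ i) = 1) (n : ℕ) (i : ι) :
    (P ^ n).mulVec 1 i ≤ truncBinom a n m := by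
  have key : ∀ n i, (P ^ n).mulVec 1 i ≤ v i * majorant a ρ y n (κ i) := by
    intro n
    induction n with
    | zero => intro i; simp [majorant, hκv]
    | succ n ih =>
      intro i
      have hyi : 0 ≤ y (κ i) := by
        by_contra h
        nlinarith [hκv i, hv i]
      set V := majorant a ρ y n (κ i) with hV
      set s := slope a ρ n (κ i) with hs
      have hs0 : 0 ≤ s := slope_nonneg ha hρ0 hρ1 n _
      have hsV : 0 ≤ V - s * y (κ i) := sub_nonneg.2 (slope_mul_le_majorant ha hρ0 hρ1 n hyi)
      calc (P ^ (n + 1)).mulVec 1 i = ∑ j, P i j * (P ^ n).mulVec 1 j :=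
            pow_succ_mulVec_apply P n 1 i
        -- Each `Fₙ(1/vⱼ)` is replaced by the tangent at `1/vᵢ`. Multiplied by `vⱼ`, this becomes a
        -- combination of `vⱼ` and `1`, precisely the two vectors on which `P` is controlled.
        _ ≤ ∑ j, ((V - s * y (κ i)) * (P i j * v j) + s * P i j) := by
            refine Finset.sum_le_sum fun j _ => ?_
            have h1 := majorant_le_tangent ha hρ0 hρ1 hy hanti n (hκ j) (hκ i)
            have h2 := (ih j).trans (mul_le_mul_of_nonneg_left h1 (hv j).le)
            have h3 := mul_le_mul_of_nonneg_left h2 (hP i j)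
            refine h3.trans_eq ?_
            linear_combination P i j * s * hκv j
        _ = (V - s * y (κ i)) * ∑ j, P i j * v j + s * ∑ j, P i j := by
            rw [Finset.sum_add_distrib, Finset.mul_sum, Finset.mul_sum]
        _ ≤ (V - s * y (κ i)) * v i + s * (1 + a) :=
            add_le_add (mul_le_mul_of_nonneg_left (hPv i) hsV)
              (mul_le_mul_of_nonneg_left (hP1 i) hs0)
        _ = v i * majorant a ρ y (n + 1) (κ i) := by
            rw [majorant, ← hV, ← hs]
            linear_combination (- s - a * s) * hκv i
  have hyi : 0 ≤ y (κ i) := by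
    by_contra h
    nlinarith [hκv i, hv i]
  calc (P ^ n).mulVec 1 i ≤ v i * majorant a ρ y n (κ i) := key n i
    _ ≤ v i * (y (κ i) * truncBinom a n (κ i + 1)) :=
        mul_le_mul_of_nonneg_left (majorant_le ha hρ0 hρ1 n hyi) (hv i).le
    _ = truncBinom a n (κ i + 1) := by rw [← mul_assoc, hκv, one_mul]
    _ ≤ truncBinom a n m := truncBinom_mono ha n (hκ i)

/-- For all small `a`, the powers of a nonnegative matrix `P` with superharmonic vector `v` and row
sums at most `1 + a` are bounded by the truncated binomial expansion of `(1 + a) ^ n`. -/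
lemma eventually_pow_mulVec_one_le {v : ι → ℝ} (hv : ∀ i, 0 < v i) :
    ∀ᶠ a : ℝ in 𝓝 0, 0 ≤ a → ∀ P : Matrix ι ι ℝ, (∀ i j, 0 ≤ P i j) →
      (∀ i, ∑ j, P i j * v j ≤ v i) → (∀ i, ∑ j, P i j ≤ 1 + a) →
      ∀ n i, (P ^ n).mulVec 1 i ≤ truncBinom a n (Fintype.card ι) := by
  classical
  set S : Finset ℝ := Finset.univ.image v with hS
  set m := S.card with hm
  have hmle : m ≤ Fintype.card ι := Finset.card_image_le
  set e := S.orderEmbOfFin hm.symm with he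
  have hepos : ∀ k, 0 < e k := by
    intro k
    obtain ⟨i, -, hi⟩ := Finset.mem_image.1 (S.orderEmbOfFin_mem hm.symm k)
    rw [he, ← hi]; exact hv i
  have hκ : ∀ i, ∃ k : Fin m, e k = v i := by
    intro i
    have : v i ∈ Set.range e := by
      rw [he, Finset.range_orderEmbOfFin]; simp [hS]
    exact this
  choose κ hκ using hκ
  -- The embedding `e` lists the values of `v` increasingly, so the breakpoints `y` decrease; the
  -- value `0` beyond `m` is a filler.
  set y : ℕ → ℝ := fun k => if h : k < m then (e ⟨k, h⟩)⁻¹ else 0 with hy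
  have hlt : ∀ k, k + 1 < m → y (k + 1) < y k := by
    intro k hk
    have hk' : k < m := by omega
    simp only [hy, hk, hk', dif_pos]
    refine inv_strictAnti₀ (hepos _) (e.strictMono ?_)
    simp
  have hypos : ∀ k, k < m → 0 < y k := by
    intro k hk
    simp only [hy, hk, dif_pos]
    exact inv_pos.2 (hepos _)
  have hsmall : ∀ᶠ a : ℝ in 𝓝 0, ∀ k ∈ Finset.range m, k + 1 < m →
      a * y (k + 1) < y k - y (k + 1) := by
    rw [Filter.eventually_all_finset]
    intro k _
    by_cases hk : k + 1 < m
    · have : Tendsto (fun a : ℝ => a * y (k + 1)) (𝓝 0) (𝓝 (0 * y (k + 1))) :=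
        tendsto_id.mul_const _
      rw [zero_mul] at this
      filter_upwards [this.eventually_lt_const (sub_pos.2 (hlt k hk))] with a ha _ using ha
    · exact Eventually.of_forall fun a h => absurd h hk
  filter_upwards [hsmall] with a hsm ha P hP hPv hP1 n i
  -- This quotient is forced by the relation between slopes and values, and `hsm` says that it is at
  -- most `1`. At `k = 0` the denominator is `y 0 - y 0`, so the quotient is `0` by convention.
  let ρ : ℕ → ℝ := fun k => if k < m then a * y k / (y (k - 1) - y k) else 0
  refine (pow_mulVec_one_le_of_values (ρ := ρ) (y := y) (m := m) ha
    ?_ ?_ ?_ (fun k hk => (hlt k hk).le) hP hv hPv hP1 (κ := fun i => κ i) (fun i => (κ i).2) ?_ n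
    i).trans (truncBinom_mono ha n hmle)
  · intro k
    rcases k with _ | k
    · simp [ρ]
    · by_cases hk : k + 1 < m
      · simp only [ρ, hk, if_true, Nat.add_sub_cancel]
        exact div_nonneg (mul_nonneg ha (hypos _ hk).le) (sub_pos.2 (hlt k hk)).le
      · simp [ρ, hk]
  · intro k
    rcases k with _ | k
    · simp [ρ]
    · by_cases hk : k + 1 < m
      · simp only [ρ, hk, if_true, Nat.add_sub_cancel]
        exact (div_le_one (sub_pos.2 (hlt k hk))).2 (hsm k (by simp; omega) hk).le
      · simp [ρ, hk]
  · intro k hk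
    simp only [ρ, hk, if_true, Nat.add_sub_cancel]
    exact div_mul_cancel₀ _ (sub_pos.2 (hlt k hk)).ne'
  · intro i
    have : (κ i : ℕ) < m := (κ i).2
    simp only [hy, this, dif_pos, Fin.eta, hκ]
    exact mul_inv_cancel₀ (hv i).ne'

end Power

/-! ### Uniformization and bounds on the matrix exponential -/

section Exponential

variable {ι : Type*} [Fintype ι] [DecidableEq ι]

attribute [local instance] Matrix.linftyOpNormedRing Matrix.linftyOpNormedAlgebra in
lemma hasSum_exp_smul_apply (A : Matrix ι ι ℝ) (t : ℝ) (i j : ι) :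
    HasSum (fun n : ℕ => t ^ n / (n.factorial : ℝ) * (A ^ n) i j)
      (NormedSpace.exp (t • A) i j) := by
  have h := NormedSpace.exp_series_hasSum_exp' (𝕂 := ℝ) (t • A)
  have h2 := (Matrix.entryLinearMap ℝ ℝ i j).toContinuousLinearMap.hasSum h
  refine h2.congr_fun fun n => ?_
  simp [smul_pow]
  ring

lemma hasSum_exp_smul_mulVec (A : Matrix ι ι ℝ) (t : ℝ) (u : ι → ℝ) (i : ι) :
    HasSum (fun n : ℕ => t ^ n / (n.factorial : ℝ) * (A ^ n).mulVec u i)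
      ((NormedSpace.exp (t • A)).mulVec u i) := by
  simp only [Matrix.mulVec, dotProduct, Finset.mul_sum]
  refine hasSum_sum fun j _ => ?_
  simpa only [mul_assoc] using (hasSum_exp_smul_apply A t i j).mul_right (u j)

lemma exp_smul_add_smul_one (A : Matrix ι ι ℝ) (t d : ℝ) :
    NormedSpace.exp (t • (A + d • (1 : Matrix ι ι ℝ))) =
      Real.exp (t * d) • NormedSpace.exp (t • A) := by
  have h1 : t • (A + d • (1 : Matrix ι ι ℝ)) = t • A + Matrix.diagonal (fun _ => t * d) := by
    rw [smul_add, smul_smul, Matrix.smul_one_eq_diagonal]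
  have h2 : Matrix.diagonal (fun _ : ι => t * d) = (t * d) • (1 : Matrix ι ι ℝ) := by
    rw [Matrix.smul_one_eq_diagonal]
  rw [h1, Matrix.exp_add_of_commute _ _ (by rw [h2]; exact (Commute.one_right _).smul_right _),
    Matrix.exp_diagonal]
  have h3 : NormedSpace.exp (fun _ : ι => t * d) = fun _ => Real.exp (t * d) := by
    ext i
    rw [Pi.coe_exp, Real.exp_eq_exp_ℝ]
  rw [h3, ← Matrix.smul_one_eq_diagonal, Matrix.mul_smul, mul_one]

lemma hasSum_exp_mul_exp_smul_mulVec (A : Matrix ι ι ℝ) (t d : ℝ) (u : ι → ℝ) (i : ι) :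
    HasSum (fun n : ℕ => t ^ n / (n.factorial : ℝ) *
        ((A + d • (1 : Matrix ι ι ℝ)) ^ n).mulVec u i)
      (Real.exp (t * d) * (NormedSpace.exp (t • A)).mulVec u i) := by
  have h := hasSum_exp_smul_mulVec (A + d • (1 : Matrix ι ι ℝ)) t u i
  rwa [exp_smul_add_smul_one, Matrix.smul_mulVec, Pi.smul_apply, smul_eq_mul] at h

lemma hasSum_real_exp (x : ℝ) :
    HasSum (fun n : ℕ => x ^ n / (n.factorial : ℝ)) (Real.exp x) := by
  rw [Real.exp_eq_exp_ℝ]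
  exact NormedSpace.expSeries_div_hasSum_exp x

/-- Up to the factor `e^x`, these are the binomial moments of the Poisson distribution; the first
`k` terms vanish and the rest is a shifted exponential series. -/
lemma hasSum_pow_div_factorial_mul_choose (x : ℝ) (k : ℕ) :
    HasSum (fun n : ℕ => x ^ n / (n.factorial : ℝ) * (n.choose k : ℝ))
      (x ^ k / (k.factorial : ℝ) * Real.exp x) := by
  rw [← hasSum_nat_add_iff' k, Finset.sum_eq_zero, sub_zero]
  · refine ((hasSum_real_exp x).mul_left (x ^ k / (k.factorial : ℝ))).congr_fun fun n => ?_
    have h := Nat.add_choose_mul_factorial_mul_factorial n k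
    have h' : ((n + k).choose k : ℝ) * n.factorial * k.factorial = (n + k).factorial := by
      exact_mod_cast h
    have hn : (n.factorial : ℝ) ≠ 0 := by positivity
    have hk : (k.factorial : ℝ) ≠ 0 := by positivity
    have hnk : ((n + k).factorial : ℝ) ≠ 0 := by positivity
    rw [← h'] at hnk ⊢
    have hc := left_ne_zero_of_mul (left_ne_zero_of_mul hnk)
    field_simp
    ring
  · intro n hn
    rw [Nat.choose_eq_zero_of_lt (Finset.mem_range.1 hn)]
    simp

/-- The survival function at `t` of the Erlang distribution with `p` phases and rate `σ`. -/
noncomputable def erlangSurvival (p : ℕ) (σ t : ℝ) : ℝ :=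
  Real.exp (-(σ * t)) * ∑ k ∈ Finset.range p, (σ * t) ^ k / (k.factorial : ℝ)

lemma hasSum_truncBinom (x a : ℝ) (p : ℕ) :
    HasSum (fun n : ℕ => x ^ n / (n.factorial : ℝ) * truncBinom a n p)
      (Real.exp x * ∑ k ∈ Finset.range p, (a * x) ^ k / (k.factorial : ℝ)) := by
  simp only [truncBinom, Finset.mul_sum]
  refine hasSum_sum fun k _ => ?_
  have h := (hasSum_pow_div_factorial_mul_choose x k).mul_right (a ^ k)
  rw [show Real.exp x * ((a * x) ^ k / (k.factorial : ℝ)) =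
    x ^ k / (k.factorial : ℝ) * Real.exp x * a ^ k by rw [mul_pow]; ring]
  simpa only [mul_assoc] using h

lemma eventually_add_smul_one_nonneg {A : Matrix ι ι ℝ} (hA : ∀ i j, i ≠ j → 0 ≤ A i j) :
    ∀ᶠ d : ℝ in atTop, ∀ i j, 0 ≤ (A + d • (1 : Matrix ι ι ℝ)) i j := by
  rw [Filter.eventually_all]
  intro i
  rw [Filter.eventually_all]
  intro j
  filter_upwards [eventually_ge_atTop (-A i i)] with d hd
  by_cases h : i = j
  · subst h; simp; linarith
  · simp [h, hA i j h]

lemma exp_smul_mulVec_one_le {A : Matrix ι ι ℝ} (hA : ∀ i j, i ≠ j → 0 ≤ A i j)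
    (hA1 : ∀ i, ∑ j, A i j ≤ 0) {σ : ℝ} (hσ : 0 ≤ σ) {v : ι → ℝ} (hv : ∀ i, 0 < v i)
    (hAv : ∀ i, A.mulVec v i ≤ -σ * v i) {t : ℝ} (ht : 0 ≤ t) (i : ι) :
    (NormedSpace.exp (t • A)).mulVec 1 i ≤ erlangSurvival (Fintype.card ι) σ t := by
  have h1 : Tendsto (fun c : ℝ => σ / c) atTop (𝓝 0) := tendsto_const_nhds.div_atTop tendsto_id
  have h2 := h1.eventually (eventually_pow_mulVec_one_le (ι := ι) hv)
  have h3 : Tendsto (fun c : ℝ => c + σ) atTop atTop := tendsto_atTop_add_const_right _ _ tendsto_id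
  have h4 := h3.eventually (eventually_add_smul_one_nonneg hA)
  -- The rate `c` is large for two reasons: `A + (c + σ)I` must be nonnegative, and `a = σ / c` must
  -- be small enough for the majorants to stay concave.
  obtain ⟨c, hc2, hc4, hc⟩ := (h2.and (h4.and (eventually_gt_atTop 0))).exists
  set B := A + (c + σ) • (1 : Matrix ι ι ℝ) with hB
  have hBs : ∀ (i : ι) (u : ι → ℝ), ∑ j, B i j * u j = A.mulVec u i + (c + σ) * u i := by
    intro i u
    change B.mulVec u i = _
    rw [hB, Matrix.add_mulVec, Matrix.smul_mulVec, Matrix.one_mulVec]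
    rfl
  have hpow := hc2 (div_nonneg hσ hc.le) (c⁻¹ • B)
    (fun i j => mul_nonneg (inv_nonneg.2 hc.le) (hc4 i j))
    (fun i => by
      simp only [Matrix.smul_apply, smul_eq_mul, mul_assoc]
      rw [← Finset.mul_sum, hBs, inv_mul_le_iff₀ hc]
      linarith [hAv i])
    (fun i => by
      have h := hBs i 1
      simp only [Pi.one_apply, mul_one] at h
      simp only [Matrix.smul_apply, smul_eq_mul]
      rw [← Finset.mul_sum, h, inv_mul_le_iff₀ hc, mul_add, mul_div_cancel₀ _ hc.ne']
      have := hA1 i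
      simp only [Matrix.mulVec, dotProduct, Pi.one_apply, mul_one]
      linarith)
  have hle : Real.exp (t * (c + σ)) * (NormedSpace.exp (t • A)).mulVec 1 i ≤
      Real.exp (t * c) * ∑ k ∈ Finset.range (Fintype.card ι),
        (σ / c * (t * c)) ^ k / (k.factorial : ℝ) := by
    refine hasSum_le (fun n => ?_) (hasSum_exp_mul_exp_smul_mulVec A t (c + σ) 1 i)
      (hasSum_truncBinom (t * c) (σ / c) (Fintype.card ι))
    have h := hpow n i
    rw [smul_pow, Matrix.smul_mulVec, Pi.smul_apply, smul_eq_mul, inv_pow,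
      inv_mul_le_iff₀ (pow_pos hc n)] at h
    rw [mul_pow, mul_div_right_comm, mul_assoc]
    exact mul_le_mul_of_nonneg_left h (by positivity)
  rw [show σ / c * (t * c) = σ * t by field_simp] at hle
  rw [erlangSurvival]
  have h5 : Real.exp (t * c) = Real.exp (t * (c + σ)) * Real.exp (-(σ * t)) := by
    rw [← Real.exp_add]; congr 1; ring
  rw [h5, mul_assoc] at hle
  exact le_of_mul_le_mul_left hle (Real.exp_pos _)

/-- After a shift by `d ≥ ν` the matrix is nonnegative with row sums at least `d - ν`, so its `n`th
power has row sums at least `(d - ν)^n`; exponential summation then undoes the shift. -/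
lemma exp_neg_le_exp_smul_mulVec_one {A : Matrix ι ι ℝ} (hA : ∀ i j, i ≠ j → 0 ≤ A i j)
    {ν : ℝ} (hA1 : ∀ i, -ν ≤ ∑ j, A i j) {t : ℝ} (ht : 0 ≤ t) (i : ι) :
    Real.exp (-(ν * t)) ≤ (NormedSpace.exp (t • A)).mulVec 1 i := by
  obtain ⟨d, hd, hdν⟩ := ((eventually_add_smul_one_nonneg hA).and (eventually_ge_atTop ν)).exists
  set B := A + d • (1 : Matrix ι ι ℝ) with hB
  have hpow : ∀ n i, (d - ν) ^ n ≤ (B ^ n).mulVec 1 i := by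
    intro n
    induction n with
    | zero => intro i; simp
    | succ n ih =>
      intro i
      rw [pow_succ_mulVec_apply]
      calc (d - ν) ^ (n + 1) = (d - ν) * (d - ν) ^ n := pow_succ' _ _
        _ ≤ (∑ j, B i j) * (d - ν) ^ n := by
          refine mul_le_mul_of_nonneg_right ?_ (pow_nonneg (sub_nonneg.2 hdν) n)
          have : ∑ j, B i j = ∑ j, A i j + d := by
            simp [hB, Finset.sum_add_distrib, Matrix.one_apply]
          linarith [hA1 i]
        _ = ∑ j, B i j * (d - ν) ^ n := Finset.sum_mul _ _ _
        _ ≤ ∑ j, B i j * (B ^ n).mulVec 1 j :=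
          Finset.sum_le_sum fun j _ => mul_le_mul_of_nonneg_left (ih j) (hd i j)
  have hle : Real.exp (t * (d - ν)) ≤
      Real.exp (t * d) * (NormedSpace.exp (t • A)).mulVec 1 i := by
    refine hasSum_le (fun n => ?_) (hasSum_real_exp (t * (d - ν)))
      (hasSum_exp_mul_exp_smul_mulVec A t d 1 i)
    rw [mul_pow, mul_div_right_comm]
    exact mul_le_mul_of_nonneg_left (hpow n i) (by positivity)
  rw [show t * (d - ν) = t * d + -(ν * t) by ring, Real.exp_add] at hle
  exact le_of_mul_le_mul_left hle (Real.exp_pos _)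

end Exponential

/-! ### A positive supersolution from the spectral gap -/

section Spectrum

variable {ι : Type*} [Fintype ι] [DecidableEq ι]

lemma exists_hasEigenvalue_of_det_eq_zero {A : Matrix ι ι ℝ} {r : ℝ}
    (h : (r • (1 : Matrix ι ι ℝ) - A).det = 0) :
    Module.End.HasEigenvalue (Matrix.toLin' (A.map Complex.ofReal)) (r : ℂ) := by
  obtain ⟨x, hx, hx0⟩ := Matrix.exists_mulVec_eq_zero_iff.2 h
  rw [Matrix.sub_mulVec, Matrix.smul_mulVec, Matrix.one_mulVec, sub_eq_zero] at hx0
  refine Module.End.hasEigenvalue_of_hasEigenvector (x := fun i => (x i : ℂ))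
    (Module.End.hasEigenvector_iff.2 ⟨Module.End.mem_eigenspace_iff.2 ?_, ?_⟩)
  · ext i
    have := congrFun hx0 i
    simp only [Matrix.toLin'_apply, Matrix.mulVec, dotProduct, Matrix.map_apply, Pi.smul_apply,
      smul_eq_mul] at this ⊢
    rw [← Complex.ofReal_mul, this]
    push_cast
    rfl
  · intro h0
    exact hx (funext fun i => by simpa using congrFun h0 i)

lemma pos_of_nonneg_of_mulVec_pos {A : Matrix ι ι ℝ} (hA : ∀ i j, i ≠ j → 0 ≤ A i j) {r : ℝ}
    {v : ι → ℝ} (hv : ∀ i, 0 ≤ v i) (h : ∀ i, 0 < (r • (1 : Matrix ι ι ℝ) - A).mulVec v i)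
    (i : ι) : 0 < v i := by
  refine (hv i).lt_of_ne fun h0 => ?_
  have h1 := h i
  rw [Matrix.sub_mulVec, Matrix.smul_mulVec, Matrix.one_mulVec, Pi.sub_apply, Pi.smul_apply,
    ← h0, smul_zero, zero_sub, Left.neg_pos_iff] at h1
  refine absurd h1 (not_lt.2 (Finset.sum_nonneg fun j _ => ?_))
  by_cases hij : i = j
  · subst hij; simp [← h0]
  · exact mul_nonneg (hA i j hij) (hv j)

/-- A minimum principle: at an index where `v` attains a negative minimum, the sign conditions on
`A` would force `(A v)ₖ ≥ 0`. -/
lemma nonneg_of_mulVec_pos_of_sum_nonpos {A : Matrix ι ι ℝ} (hA : ∀ i j, i ≠ j → 0 ≤ A i j)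
    (hA1 : ∀ i, ∑ j, A i j ≤ 0)
    {v : ι → ℝ} (h : ∀ i, 0 < (-A).mulVec v i) (i : ι) : 0 ≤ v i := by
  obtain ⟨k, -, hk⟩ := Finset.exists_min_image Finset.univ v ⟨i, Finset.mem_univ i⟩
  refine le_trans ?_ (hk i (Finset.mem_univ i))
  by_contra hneg
  rw [not_le] at hneg
  have h1 := h k
  rw [Matrix.neg_mulVec, Pi.neg_apply, Left.neg_pos_iff] at h1
  refine absurd h1 (not_lt.2 ?_)
  calc 0 ≤ (∑ j, A k j) * v k := mul_nonneg_of_nonpos_of_nonpos (hA1 k) hneg.le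
    _ = ∑ j, A k j * v k := Finset.sum_mul _ _ _
    _ ≤ ∑ j, A k j * v j := by
      refine Finset.sum_le_sum fun j _ => ?_
      by_cases hkj : k = j
      · rw [hkj]
      · exact mul_le_mul_of_nonneg_left (hk j (Finset.mem_univ j)) (hA k j hkj)

/-- A matrix with nonnegative off-diagonal entries, nonpositive row sums and no real eigenvalue in
`[-σ, 0]` has a positive vector `v` with `A v ≤ -σ v`. -/
lemma exists_pos_mulVec_le {A : Matrix ι ι ℝ} (hA : ∀ i j, i ≠ j → 0 ≤ A i j)
    (hA1 : ∀ i, ∑ j, A i j ≤ 0) {σ : ℝ} (hσ : 0 ≤ σ)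
    (hdet : ∀ r ∈ Set.Icc (-σ) 0, (r • (1 : Matrix ι ι ℝ) - A).det ≠ 0) :
    ∃ v : ι → ℝ, (∀ i, 0 < v i) ∧ ∀ i, A.mulVec v i ≤ -σ * v i := by
  let M : ℝ → Matrix ι ι ℝ := fun r => (-r) • (1 : Matrix ι ι ℝ) - A
  let v : ℝ → ι → ℝ := fun r => (M r)⁻¹.mulVec 1
  have hdet' : ∀ r ∈ Set.Icc 0 σ, (M r).det ≠ 0 := fun r hr =>
    hdet (-r) ⟨neg_le_neg hr.2, neg_nonpos.2 hr.1⟩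
  have hMv : ∀ r ∈ Set.Icc 0 σ, (M r).mulVec (v r) = 1 := by
    intro r hr
    simp only [v]
    rw [Matrix.mulVec_mulVec, Matrix.mul_nonsing_inv _ (isUnit_iff_ne_zero.2 (hdet' r hr)),
      Matrix.one_mulVec]
  have hM : Continuous M := by fun_prop
  have hcont : ∀ i, ContinuousOn (fun r => v r i) (Set.Icc 0 σ) := by
    intro i
    have : (fun r => v r i) = fun r => (M r).det⁻¹ * ((M r).adjugate.mulVec 1 i) := by
      ext r
      simp only [v]
      rw [Matrix.inv_def, Ring.inverse_eq_inv', Matrix.smul_mulVec]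
      rfl
    rw [this]
    refine ContinuousOn.mul (ContinuousOn.inv₀ hM.matrix_det.continuousOn hdet') ?_
    refine Continuous.continuousOn ?_
    exact (continuous_apply i).comp (hM.matrix_adjugate.matrix_mulVec continuous_const)
  have hpos : ∀ r ∈ Set.Icc 0 σ, (∀ i, 0 ≤ v r i) → ∀ i, 0 < v r i := by
    intro r hr h
    refine pos_of_nonneg_of_mulVec_pos hA (r := -r) h fun i => ?_
    have := congrFun (hMv r hr) i
    simp only [M] at this
    rw [this]; exact one_pos
  -- Continuation in `r` of the solution of `(-r - A) v = 𝟏`: nonnegativity holds at `r = 0` by the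
  -- minimum principle, is a closed condition, and persists to the right because a nonnegative
  -- solution is automatically strictly positive.
  have hmain : Set.Icc 0 σ ⊆ {r | ∀ i, 0 ≤ v r i} := by
    refine IsClosed.Icc_subset_of_forall_mem_nhdsWithin ?_ ?_ ?_
    · have : {r | ∀ i, 0 ≤ v r i} ∩ Set.Icc 0 σ =
          Set.Icc 0 σ ∩ ⋂ i, Set.Icc 0 σ ∩ (fun r => v r i) ⁻¹' Set.Ici 0 := by
        ext r
        simp only [Set.mem_inter_iff, Set.mem_ofPred_eq, Set.mem_iInter, Set.mem_preimage,
          Set.mem_Ici]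
        exact ⟨fun h => ⟨h.2, fun i => ⟨h.2, h.1 i⟩⟩, fun h => ⟨fun i => (h.2 i).2, h.1⟩⟩
      rw [this]
      exact isClosed_Icc.inter (isClosed_iInter fun i =>
        (hcont i).preimage_isClosed_of_isClosed isClosed_Icc isClosed_Ici)
    · intro i
      have h0 : (0 : ℝ) ∈ Set.Icc 0 σ := ⟨le_rfl, hσ⟩
      refine nonneg_of_mulVec_pos_of_sum_nonpos hA hA1 (fun i => ?_) i
      have := congrFun (hMv 0 h0) i
      simp only [M, neg_zero, zero_smul, zero_sub] at this
      rw [this]; exact one_pos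
    · rintro r ⟨hr, hr1⟩
      have hrI : r ∈ Set.Icc 0 σ := Set.Ico_subset_Icc_self hr1
      have h := hpos r hrI hr
      have h2 : ∀ᶠ s in 𝓝[Set.Icc 0 σ] r, ∀ i, 0 ≤ v s i := by
        rw [Filter.eventually_all]
        intro i
        filter_upwards [(hcont i r hrI).eventually_const_lt (h i)] with s hs using hs.le
      have h3 : 𝓝[>] r ≤ 𝓝[Set.Icc 0 σ] r := by
        rw [← nhdsWithin_Ioc_eq_nhdsGT hr1.2]
        exact nhdsWithin_mono _ fun s hs => ⟨hr1.1.trans hs.1.le, hs.2⟩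
      exact h3 h2
  have hσI : σ ∈ Set.Icc 0 σ := ⟨hσ, le_rfl⟩
  refine ⟨v σ, hpos σ hσI (hmain hσI), fun i => ?_⟩
  have h := congrFun (hMv σ hσI) i
  simp only [M] at h
  rw [Matrix.sub_mulVec, Matrix.smul_mulVec, Matrix.one_mulVec, Pi.sub_apply, Pi.smul_apply,
    smul_eq_mul, Pi.one_apply] at h
  linarith

end Spectrum

/-! ### Erlang tails -/

section Erlang

/-- Differentiating the partial exponential sum telescopes, leaving minus the Erlang density. -/
lemma hasDerivAt_erlangSurvival (p : ℕ) (σ t : ℝ) :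
    HasDerivAt (erlangSurvival (p + 1) σ)
      (-(σ * (Real.exp (-(σ * t)) * ((σ * t) ^ p / (p.factorial : ℝ))))) t := by
  have hlin : HasDerivAt (fun t => σ * t) σ t := by
    simpa using (hasDerivAt_id t).const_mul σ
  have hexp : HasDerivAt (fun t => Real.exp (-(σ * t))) (Real.exp (-(σ * t)) * -σ) t :=
    hlin.neg.exp
  induction p with
  | zero =>
    have : erlangSurvival (0 + 1) σ = fun t => Real.exp (-(σ * t)) := by
      ext t; simp [erlangSurvival]
    rw [this]
    convert hexp using 1
    simp; ring
  | succ p ih =>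
    have : erlangSurvival (p + 1 + 1) σ = fun t => erlangSurvival (p + 1) σ t +
        Real.exp (-(σ * t)) * ((σ * t) ^ (p + 1) / ((p + 1).factorial : ℝ)) := by
      ext t; rw [erlangSurvival, Finset.sum_range_succ, mul_add]; rfl
    rw [this]
    have hpow : HasDerivAt (fun t => (σ * t) ^ (p + 1)) (((p + 1 : ℕ) : ℝ) * (σ * t) ^ p * σ) t :=
      hlin.pow (p + 1)
    refine (ih.add (hexp.mul (hpow.div_const ((p + 1).factorial : ℝ)))).congr_deriv ?_
    rw [Nat.factorial_succ]
    have hp : (p.factorial : ℝ) ≠ 0 := by positivity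
    push_cast
    field_simp
    ring

lemma tendsto_erlangSurvival (p : ℕ) {σ : ℝ} (hσ : 0 < σ) :
    Tendsto (erlangSurvival p σ) atTop (𝓝 0) := by
  have h1 : Tendsto (fun x : ℝ => Real.exp (-x) *
      ∑ k ∈ Finset.range p, x ^ k / (k.factorial : ℝ)) atTop (𝓝 0) := by
    simp only [Finset.mul_sum]
    rw [show (0 : ℝ) = ∑ k ∈ Finset.range p, 0 / (k.factorial : ℝ) by simp]
    refine tendsto_finsetSum _ fun k _ => ?_
    refine ((Real.tendsto_pow_mul_exp_neg_atTop_nhds_zero k).div_const _).congr fun x => ?_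
    ring
  exact h1.comp (tendsto_id.const_mul_atTop hσ)

lemma gammaMeasure_Ioi {p : ℕ} (hp : 0 < p) {σ : ℝ} (hσ : 0 < σ) {x : ℝ} (hx : 0 ≤ x) :
    gammaMeasure (p : ℝ) σ (Set.Ioi x) = ENNReal.ofReal (erlangSurvival p σ x) := by
  obtain ⟨p, rfl⟩ := Nat.exists_eq_succ_of_ne_zero hp.ne'
  let g : ℝ → ℝ := fun t => σ * (Real.exp (-(σ * t)) * ((σ * t) ^ p / (p.factorial : ℝ)))
  have hpdf : ∀ t ∈ Set.Ioi x, gammaPDF ((p.succ : ℕ) : ℝ) σ t = ENNReal.ofReal (g t) := by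
    intro t ht
    rw [gammaPDF_of_nonneg (hx.trans (le_of_lt ht))]
    congr 1
    simp only [g]
    rw [Nat.succ_eq_add_one, Real.rpow_natCast, Nat.cast_add, Nat.cast_one,
      Real.Gamma_nat_eq_factorial, add_sub_cancel_right, Real.rpow_natCast]
    ring
  have hg0 : ∀ t ∈ Set.Ioi x, 0 ≤ g t := by
    intro t ht
    have : 0 ≤ t := hx.trans (le_of_lt ht)
    positivity
  have hderiv : ∀ t ∈ Set.Ici x, HasDerivAt (fun t => -erlangSurvival (p + 1) σ t) (g t) t :=
    fun t _ => (hasDerivAt_erlangSurvival p σ t).neg.congr_deriv (neg_neg _)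
  have hlim : Tendsto (fun t => -erlangSurvival (p + 1) σ t) atTop (𝓝 0) := by
    simpa using (tendsto_erlangSurvival (p + 1) hσ).neg
  have hint := integrableOn_Ioi_deriv_of_nonneg' hderiv hg0 hlim
  have hval := integral_Ioi_of_hasDerivAt_of_tendsto' hderiv hint hlim
  rw [gammaMeasure, withDensity_apply _ measurableSet_Ioi,
    setLIntegral_congr_fun measurableSet_Ioi hpdf,
    ← ofReal_integral_eq_lintegral_ofReal hint
      ((ae_restrict_iff' measurableSet_Ioi).2 (ae_of_all _ hg0)), hval]
  simp

lemma gammaMeasure_Ioi_of_neg {p : ℕ} (hp : 0 < p) {σ : ℝ} (hσ : 0 < σ) {x : ℝ} (hx : x ≤ 0) :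
    1 ≤ gammaMeasure (p : ℝ) σ (Set.Ioi x) := by
  refine le_trans ?_ (measure_mono (Set.Ioi_subset_Ioi hx))
  rw [gammaMeasure_Ioi hp hσ le_rfl]
  obtain ⟨p, rfl⟩ := Nat.exists_eq_succ_of_ne_zero hp.ne'
  simp [erlangSurvival, Finset.sum_range_succ']

lemma erlangSurvival_mono {p q : ℕ} (h : p ≤ q) {σ t : ℝ} (hσ : 0 ≤ σ) (ht : 0 ≤ t) :
    erlangSurvival p σ t ≤ erlangSurvival q σ t :=
  mul_le_mul_of_nonneg_left
    (Finset.sum_le_sum_of_subset_of_nonneg (Finset.range_mono h) fun _ _ _ => by positivity)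
    (Real.exp_pos _).le

end Erlang

/-! ### The survival function of a phase-type variable -/

section Survival

variable {p : ℕ} {A : Matrix (Fin p) (Fin p) ℝ}

lemma generator_pow_none_some (n : ℕ) (j : Fin p) : (generator A ^ n) none (some j) = 0 := by
  cases n with
  | zero => simp
  | succ n =>
    rw [pow_succ', Matrix.mul_apply]
    exact Finset.sum_eq_zero fun x _ => zero_mul _

lemma generator_pow_some_some (n : ℕ) (i j : Fin p) :
    (generator A ^ n) (some i) (some j) = (A ^ n) i j := by
  induction n generalizing i with
  | zero => simp [Matrix.one_apply]
  | succ n ih =>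
    rw [pow_succ', pow_succ', Matrix.mul_apply, Matrix.mul_apply, Fintype.sum_option,
      generator_pow_none_some, mul_zero, zero_add]
    exact Finset.sum_congr rfl fun k _ => by rw [ih]; rfl

lemma exp_generator_none_some (t : ℝ) (j : Fin p) :
    NormedSpace.exp (t • generator A) none (some j) = 0 := by
  refine (hasSum_exp_smul_apply (generator A) t none (some j)).unique ?_
  simp only [generator_pow_none_some, mul_zero]
  exact hasSum_zero

lemma exp_generator_some_some (t : ℝ) (i j : Fin p) :
    NormedSpace.exp (t • generator A) (some i) (some j) = NormedSpace.exp (t • A) i j := by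
  refine (hasSum_exp_smul_apply (generator A) t (some i) (some j)).unique ?_
  simp only [generator_pow_some_some]
  exact hasSum_exp_smul_apply A t i j

variable {Ω : Type*} [MeasurableSpace Ω] {P : Measure Ω} [IsProbabilityMeasure P]
  {α : Fin p → ℝ} {φ : ℝ≥0 → Ω → Option (Fin p)}

lemma IsMarkovJumpProcess.measureReal_eq {E : Type*} [Fintype E] [DecidableEq E] {π : E → ℝ}
    {Q : Matrix E E ℝ} {φ : ℝ≥0 → Ω → E} (hφ : IsMarkovJumpProcess P π Q φ) (x : ℝ≥0) (j : E) :
    P.real {ω | φ x ω = j} = ∑ i, π i * NormedSpace.exp ((x : ℝ) • Q) i j := by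
  have h1 : {ω | φ x ω = j} = ⋃ i ∈ Finset.univ, {ω | φ 0 ω = i} ∩ {ω | φ x ω = j} := by
    ext ω; simp
  rw [h1, measureReal_biUnion_finset]
  · refine Finset.sum_congr rfl fun i _ => ?_
    have h := hφ.finite_dim 1 ![0, x] ![i, j] rfl
      (by intro a b hab; fin_cases a <;> fin_cases b <;> simp_all)
    have hset : {ω | φ 0 ω = i} ∩ {ω | φ x ω = j} =
        {ω | ∀ k, φ ((![0, x] : Fin 2 → ℝ≥0) k) ω = (![i, j] : Fin 2 → E) k} := by
      ext ω; simp [Fin.forall_fin_two]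
    rw [hset, h, Fin.prod_univ_one]
    change π i * NormedSpace.exp (((x : ℝ) - ((0 : ℝ≥0) : ℝ)) • Q) i j = _
    rw [NNReal.coe_zero, sub_zero]
  · intro a _ b _ hab
    refine Set.disjoint_left.2 fun ω h1 h2 => hab ?_
    exact h1.1.symm.trans h2.1
  · exact fun i _ => (hφ.measurableSet_eq 0 i).inter (hφ.measurableSet_eq x j)

lemma measure_none_some (hφ : IsMarkovJumpProcess P (initialVector α) (generator A) φ)
    {s x : ℝ≥0} (hsx : s ≤ x) (j : Fin p) : P {ω | φ s ω = none ∧ φ x ω = some j} = 0 := by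
  have h1 : {ω | φ s ω = none ∧ φ x ω = some j} ⊆
      ⋃ i, {ω | φ 0 ω = i ∧ φ s ω = none ∧ φ x ω = some j} := by
    intro ω h
    exact Set.mem_iUnion.2 ⟨φ 0 ω, rfl, h⟩
  refine measure_mono_null h1 (measure_iUnion_null fun i => ?_)
  have h := hφ.finite_dim 2 ![0, s, x] ![i, none, some j] rfl
    (by intro a b hab; fin_cases a <;> fin_cases b <;> simp_all)
  rw [Fin.prod_univ_two] at h
  have h2 : NormedSpace.exp (((x : ℝ) - (s : ℝ)) • generator A) none (some j) = 0 :=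
    exp_generator_none_some _ _
  rw [show ∀ a b c : ℝ, c = 0 → a * (b * c) = 0 by intro a b c h; simp [h]] at h
  · rw [measureReal_eq_zero_iff] at h
    convert h using 3
    ext ω
    simp [Fin.forall_fin_succ]
  · exact h2

/-- The events differ only on paths that visit `⋆` before `x` and are elsewhere at `x`. By
right-continuity such a path is at `⋆` at some rational time before `x`, which leaves a countable
union of null events. -/
lemma measure_lt_absorptionTime (hφ : IsMarkovJumpProcess P (initialVector α) (generator A) φ)
    (x : ℝ≥0) : P {ω | ((x : ℝ) : EReal) < absorptionTime φ ω} = P {ω | φ x ω ≠ none} := by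
  have hsub : {ω | ((x : ℝ) : EReal) < absorptionTime φ ω} ⊆ {ω | φ x ω ≠ none} := by
    intro ω h h0
    exact absurd (sInf_le ⟨x, h0, rfl⟩ : absorptionTime φ ω ≤ _) (not_le.2 h)
  have hnull : P (⋃ q : ℚ, ⋃ j : Fin p, {ω | (q.cast : ℝ).toNNReal ≤ x ∧
      φ (q.cast : ℝ).toNNReal ω = none ∧ φ x ω = some j}) = 0 := by
    refine measure_iUnion_null fun q => measure_iUnion_null fun j => ?_
    by_cases hq : (q.cast : ℝ).toNNReal ≤ x
    · exact measure_mono_null (fun ω h => h.2) (measure_none_some hφ hq j)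
    · simp [hq]
  refine le_antisymm (measure_mono hsub) ?_
  refine (measure_mono ?_).trans
    ((measure_union_le {ω | ((x : ℝ) : EReal) < absorptionTime φ ω} _).trans_eq
      (by rw [hnull, add_zero]))
  intro ω hω
  by_contra hcon
  simp only [Set.mem_union, Set.mem_iUnion, Set.mem_ofPred_eq, not_or, not_lt, not_exists,
    not_and] at hcon
  obtain ⟨hle, hcon⟩ := hcon
  obtain ⟨j, hj⟩ := Option.ne_none_iff_exists'.1 hω
  obtain ⟨u, hxu, hu⟩ := mem_nhdsGE_iff_exists_Ico_subset.1 (hφ.right_continuous ω x)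
  have hlt : absorptionTime φ ω < ((u : ℝ) : EReal) :=
    hle.trans_lt (by exact_mod_cast (show x < u from hxu))
  -- The infimum may equal `x` without being known to be attained. Since the path avoids `⋆` on `[x,
  -- u)`, a visit before `u` must occur before `x`.
  obtain ⟨_, ⟨s, hs, rfl⟩, hsu⟩ := sInf_lt_iff.1 hlt
  have hsu' : s < u := by exact_mod_cast hsu
  have hsx : s < x := by
    by_contra h
    have := hu ⟨not_lt.1 h, hsu'⟩
    simp only [Set.mem_ofPred_eq] at this
    exact hω (this.symm.trans hs)
  obtain ⟨w, hsw, hw⟩ := mem_nhdsGE_iff_exists_Ico_subset.1 (hφ.right_continuous ω s)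
  obtain ⟨q, hq1, hq2⟩ := exists_rat_btwn
    (show (s : ℝ) < (min w x : ℝ≥0) by exact_mod_cast lt_min hsw hsx)
  have hq0 : (0 : ℝ) ≤ q := s.2.trans hq1.le
  have hq : ((q : ℝ).toNNReal : ℝ) = q := Real.coe_toNNReal _ hq0
  have h1 : s ≤ (q : ℝ).toNNReal := by rw [← NNReal.coe_le_coe, hq]; exact hq1.le
  have h2 : (q : ℝ).toNNReal < min w x := by rw [← NNReal.coe_lt_coe, hq]; exact hq2
  have h3 := hw ⟨h1, h2.trans_le (min_le_left _ _)⟩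
  exact hcon q j (h2.le.trans (min_le_right _ _)) (h3.trans hs) hj

lemma measure_ne_none (hφ : IsMarkovJumpProcess P (initialVector α) (generator A) φ) (x : ℝ≥0) :
    P {ω | φ x ω ≠ none} =
      ENNReal.ofReal (∑ i, α i * (NormedSpace.exp ((x : ℝ) • A)).mulVec 1 i) := by
  have h1 : {ω | φ x ω ≠ none} = ⋃ j ∈ Finset.univ, {ω | φ x ω = some j} := by
    ext ω; simp [Option.ne_none_iff_exists']
  rw [← ofReal_measureReal, h1, measureReal_biUnion_finset]
  · congr 1
    simp only [hφ.measureReal_eq, Fintype.sum_option, initialVector, zero_mul, zero_add,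
      exp_generator_some_some]
    rw [Finset.sum_comm]
    simp [Matrix.mulVec, dotProduct, Finset.mul_sum]
  · intro a _ b _ hab
    refine Set.disjoint_left.2 fun ω h1 h2 => hab ?_
    exact Option.some_injective _ (Eq.trans (Eq.symm h1) h2)
  · exact fun j _ => hφ.measurableSet_eq x (some j)

lemma IsPhaseType.measure_lt {α : Fin p → ℝ} {ΩY : Type*} [MeasurableSpace ΩY] {PY : Measure ΩY}
    {Y : ΩY → ℝ} (hY : IsPhaseType.{w, _} α A Y PY) {x : ℝ} (hx : 0 ≤ x) :
    PY {ω | x < Y ω} = ENNReal.ofReal (∑ i, α i * (NormedSpace.exp (x • A)).mulVec 1 i) := by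
  obtain ⟨Ω', _, P', _, φ, hφ, hid⟩ := hY.law
  lift x to ℝ≥0 using hx
  rw [← measure_ne_none hφ x, ← measure_lt_absorptionTime hφ x]
  have h := hid.measure_mem_eq (measurableSet_Ioi (a := ((x : ℝ) : EReal)))
  simpa only [Set.preimage, Set.mem_Ioi, EReal.coe_lt_coe_iff] using h

lemma IsPhaseType.measure_lt_of_neg {α : Fin p → ℝ} {ΩY : Type*} [MeasurableSpace ΩY]
    {PY : Measure ΩY} {Y : ΩY → ℝ} (hY : IsPhaseType.{w, _} α A Y PY) {x : ℝ} (hx : x < 0) :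
    PY {ω | x < Y ω} = 1 := by
  obtain ⟨Ω', _, P', _, φ, hφ, hid⟩ := hY.law
  have h := hid.measure_mem_eq (measurableSet_Ioi (a := (x : EReal)))
  have h2 : absorptionTime φ ⁻¹' Set.Ioi (x : EReal) = Set.univ := by
    refine Set.eq_univ_of_forall fun ω => ?_
    refine lt_of_lt_of_le (b := (0 : EReal)) (by exact_mod_cast hx) (le_sInf ?_)
    rintro _ ⟨t, -, rfl⟩
    exact_mod_cast t.2
  rw [h2, measure_univ] at h
  simpa only [Set.preimage, Set.mem_Ioi, EReal.coe_lt_coe_iff] using h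

end Survival

/-! ### Passing to the spectral endpoint and conclusion -/

lemma IsSubGenerator.sum_nonpos {p : ℕ} {A : Matrix (Fin p) (Fin p) ℝ} (hA : IsSubGenerator A)
    (i : Fin p) : ∑ j, A i j ≤ 0 :=
  neg_nonneg.1 (hA.exitRate_nonneg i)

/-- At `σ = -z.re` the resolvent may be singular, so the bound is proved for rates `s < σ`, where no
real eigenvalue lies in `[-s, 0]`, and then `s` tends to `σ`. -/
lemma exp_smul_mulVec_one_le_erlangSurvival {p₀ : ℕ} {A : Matrix (Fin p₀) (Fin p₀) ℝ}
    (hA : IsSubGenerator A) {z : ℂ} (hz : IsDominantEigenvalue A z) {σ : ℝ} (hσ0 : 0 < σ)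
    (hσ : σ ≤ -z.re) {t : ℝ} (ht : 0 ≤ t) (i : Fin p₀) :
    (NormedSpace.exp (t • A)).mulVec 1 i ≤ erlangSurvival p₀ σ t := by
  have hcont : Continuous fun s => erlangSurvival p₀ s t := by
    unfold erlangSurvival
    fun_prop
  refine ge_of_tendsto (hcont.continuousWithinAt (s := Set.Iio σ) (x := σ)).tendsto ?_
  filter_upwards [Ioo_mem_nhdsLT hσ0] with s hs
  obtain ⟨v, hv, hAv⟩ := exists_pos_mulVec_le hA.rate_nonneg hA.sum_nonpos hs.1.le (by
    intro r hr hdet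
    have h := hz.2 _ (exists_hasEigenvalue_of_det_eq_zero hdet)
    rw [Complex.ofReal_re] at h
    linarith [hr.1, hs.2])
  simpa using exp_smul_mulVec_one_le hA.rate_nonneg hA.sum_nonpos hs.1.le hv hAv ht i

/-- If every exit rate vanished, `𝟏` would be an eigenvector for the eigenvalue `0`. This serves to
make `ν` positive, as the exponential tail formula requires. -/
lemma exists_exitRate_pos {p₀ : ℕ} {A : Matrix (Fin p₀) (Fin p₀) ℝ} (hp₀ : 0 < p₀)
    (hA : IsSubGenerator A) {z : ℂ} (hz : IsDominantEigenvalue A z) (hz0 : z.re < 0) :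
    ∃ i, 0 < exitRate A i := by
  by_contra! h
  have hdet : ((0 : ℝ) • (1 : Matrix (Fin p₀) (Fin p₀) ℝ) - A).det = 0 := by
    refine Matrix.exists_mulVec_eq_zero_iff.1 ⟨1, ?_, ?_⟩
    · exact fun h1 => one_ne_zero (congrFun h1 ⟨0, hp₀⟩)
    · ext i
      simpa [Matrix.neg_mulVec, Matrix.mulVec, dotProduct, exitRate] using
        le_antisymm (h i) (hA.exitRate_nonneg i)
  have h2 := hz.2 _ (exists_hasEigenvalue_of_det_eq_zero hdet)
  simp only [Complex.ofReal_zero, Complex.zero_re] at h2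
  linarith

end PhaseType

theorem mainTheorem6
    {ΩY ΩL ΩH : Type*} [MeasurableSpace ΩY] [MeasurableSpace ΩL] [MeasurableSpace ΩH]
    {PY : Measure ΩY} {PL : Measure ΩL} {PH : Measure ΩH}
    [IsProbabilityMeasure PY] [IsProbabilityMeasure PL] [IsProbabilityMeasure PH]
    {p₀ : ℕ} {α : Fin p₀ → ℝ} {A : Matrix (Fin p₀) (Fin p₀) ℝ}
    {Y : ΩY → ℝ} (hY : PhaseType.IsPhaseType.{w, _} α A Y PY)
    {z : ℂ} (hz : PhaseType.IsDominantEigenvalue A z)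
    {σ₀ : ℝ} (hσ₀ : z.re = -σ₀)
    {ν₀ : ℝ} (hν₀ : IsGreatest (Set.range (PhaseType.exitRate A)) ν₀)
    {ν : ℝ} (hν : ν₀ ≤ ν) {p : ℕ} (hp : p₀ ≤ p) {σ : ℝ} (hσ_pos : 0 < σ) (hσ : σ ≤ σ₀)
    {L : ΩL → ℝ} (hL : HasLaw L (expMeasure ν) PL)
    {H : ΩH → ℝ} (hH : HasLaw H (PhaseType.erlangMeasure p σ) PH) :
    PhaseType.StochLE L PL Y PY ∧ PhaseType.StochLE Y PY H PH := by
  open PhaseType in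
  obtain ⟨i₀, -⟩ := hν₀.1
  have hp₀ : 0 < p₀ := i₀.pos
  have hA := hY.subGenerator
  have hz0 : z.re < 0 := by linarith
  obtain ⟨i₁, hi₁⟩ := exists_exitRate_pos hp₀ hA hz hz0
  have hνi : ∀ i, exitRate A i ≤ ν := fun i => (hν₀.2 ⟨i, rfl⟩).trans hν
  have hνpos : 0 < ν := hi₁.trans_le (hνi i₁)
  constructor
  · intro x
    rcases lt_or_ge x 0 with hx | hx
    · rw [hY.measure_lt_of_neg hx]
      exact prob_le_one
    · rw [hY.measure_lt hx, hL.measure_eq (p := fun y => x < y) measurableSet_Ioi]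
      -- The exponential law is the gamma law of shape `1`, so the Erlang tail formula covers it.
      have h := gammaMeasure_Ioi one_pos hνpos hx
      rw [Nat.cast_one] at h
      refine (h.trans_le (ENNReal.ofReal_le_ofReal ?_) : _)
      calc erlangSurvival 1 ν x = ∑ i, α i * Real.exp (-(ν * x)) := by
            rw [← Finset.sum_mul, hY.initial_sum]; simp [erlangSurvival]
        _ ≤ _ := Finset.sum_le_sum fun i _ => mul_le_mul_of_nonneg_left
            (exp_neg_le_exp_smul_mulVec_one hA.rate_nonneg
              (fun i => neg_le.1 (hνi i)) hx i) (hY.initial_nonneg i)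
  · intro x
    have hppos : 0 < p := hp₀.trans_le hp
    rw [hH.measure_eq (p := fun y => x < y) measurableSet_Ioi]
    rcases lt_or_ge x 0 with hx | hx
    · exact prob_le_one.trans (gammaMeasure_Ioi_of_neg hppos hσ_pos hx.le)
    · rw [hY.measure_lt hx]
      refine (ENNReal.ofReal_le_ofReal ?_).trans_eq (gammaMeasure_Ioi hppos hσ_pos hx).symm
      calc _ ≤ ∑ i, α i * erlangSurvival p₀ σ x :=
            Finset.sum_le_sum fun i _ => mul_le_mul_of_nonneg_left
              (exp_smul_mulVec_one_le_erlangSurvival hA hz hσ_pos (by linarith) hx i)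
              (hY.initial_nonneg i)
        _ = erlangSurvival p₀ σ x := by rw [← Finset.sum_mul, hY.initial_sum, one_mul]
        _ ≤ erlangSurvival p σ x := erlangSurvival_mono hp hσ_pos.le hx
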